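/- For $n\ge 1$ and $0\le\beta<\alpha\le 1$ let $A_{\alpha,\beta}\in\mathbb{R}^{n\times n}$ be the workload matrix of SGD with momentum $\beta$ and weight decay parameter $\alpha$, i.e. the lower triangular Toeplitz matrix with first column $(a_0,\dots,a_{n-1})$, $a_j=\sum_{i=0}^{j}\alpha^i\beta^{j-i}$. For $b,k,d\ge 1$, call $X,X'\in\mathbb{R}^{n\times d}$ neighbouring, $X\sim X'$, if there is a set $\pi\subseteq\{1,\dots,n\}$ with $|\pi|\le k$ and $|i-j|\ge b$ for all distinct $i,j\in\pi$, such that the rows of $X$ and $X'$ agree outside $\pi$ and differ by a vector of Euclidean norm at most $1$ in each row $i\in\pi$. For $C\in\mathbb{R}^{m\times n}$ put $\operatorname{sens}_{k,b}(C)=\sup_{X\sim X'}\|CX-CX'\|_F$. The expected approximation error of a factorization $A=BC$ with $B\in\mathbb{R}^{n\times m}$, $C\in\mathbb{R}^{m\times n}$ is $$\mathcal{E}(B,C)=\frac{1}{\sqrt n}\,\operatorname{sens}_{k,b}(C)\,\|B\|_F .$$ Consider the single-participation setting $k=1$ (with any $1\le b\le n$ and any $d\ge 1$). Theorem. There is an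 absolute constant $c>0$ such that for every $n\ge 1$, all $0\le\beta<\alpha\le1$, and every factorization $A_{\alpha,\beta}=BC$ with any inner dimension $m$ (in particular for every factorization with $C^\top C\ge 0$), $$\mathcal{E}(B,C)\ \ge\ \begin{cases} c & \text{if } \alpha<1,\\ c\,\log n & \text{if } \alpha=1.\end{cases}$$ That is, $\mathcal{E}(B,C)=\Omega(1)$ for $\alpha<1$ and $\mathcal{E}(B,C)=\Omega(\log n)$ for $\alpha=1$. Moreover, the square root factorization is asymptotically optimal: for all $0\le\beta<\alpha\le 1$ there is a constant $K>0$, depending only on $\alpha$ and $\beta$, such that for every $n\ge1$ the matrix $A_{\alpha,\beta}$ has a lower triangular square root with strictly positive diagonal entries, and any such root $R$ satisfies $\mathcal{E}(R,R)\le K\,\mathcal{E}(B,C)$ for every factorization $A_{\alpha,\beta}=BC$. -/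

import Mathlib

open scoped Matrix Matrix.Norms.Frobenius

noncomputable section

/-- The `n × n` workload matrix of SGD with weight decay `α` and momentum `β`: the lower triangular
Toeplitz matrix with first column `a_0, …, a_{n-1}`, where `a_j = ∑_{l=0}^{j} α^l β^(j-l)`. -/
def workloadMatrix (n : ℕ) (α β : ℝ) : Matrix (Fin n) (Fin n) ℝ :=
  Matrix.of fun i j =>
    if j ≤ i then
      ∑ l ∈ Finset.range ((i : ℕ) - (j : ℕ) + 1), α ^ l * β ^ ((i : ℕ) - (j : ℕ) - l)
    else 0

/-- The participation patterns of one data item: sets of at most `k` steps, any two distinct ones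
at distance at least `b`. -/
def participationSets (n k b : ℕ) : Set (Finset (Fin n)) :=
  {π | π.card ≤ k ∧
    ∀ i ∈ π, ∀ j ∈ π, i = j ∨ (b : ℤ) ≤ |((i : ℕ) : ℤ) - ((j : ℕ) : ℤ)|}

/-- Two sequences of `n` update vectors in `ℝ^d` (stacked as rows) are neighbouring if they differ
only in the steps to which a single data item contributes, the contribution of the item to each of
these steps having Euclidean norm at most `1` (clip norm `ζ = 1`). -/
def Neighboring {n d : ℕ} (k b : ℕ) (X X' : Matrix (Fin n) (Fin d) ℝ) : Prop :=
  ∃ π ∈ participationSets n k b,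
    (∀ i, i ∉ π → X i = X' i) ∧ ∀ i ∈ π, ‖WithLp.toLp 2 (X i - X' i)‖ ≤ 1

/-- The sensitivity `sens_{k,b}(C) = sup_{X ∼ X'} ‖C X - C X'‖_F` over sequences of `n` update
vectors in `ℝ^d`; here and below, `‖·‖` of a matrix is the Frobenius norm. -/
def sens {m n : ℕ} (d k b : ℕ) (C : Matrix (Fin m) (Fin n) ℝ) : ℝ :=
  sSup {r : ℝ | ∃ X X' : Matrix (Fin n) (Fin d) ℝ, Neighboring k b X X' ∧ r = ‖C * X - C * X'‖}

/-- The expected approximation error `(1/√n) sens_{k,b}(C) ‖B‖_F` of a factorization `A = B C`. -/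
def approxError {m n : ℕ} (d k b : ℕ) (B : Matrix (Fin n) (Fin m) ℝ)
    (C : Matrix (Fin m) (Fin n) ℝ) : ℝ :=
  1 / Real.sqrt n * sens d k b C * ‖B‖

/-- `A = R * R` is the square root factorization of the lower triangular matrix `A`: `R` is the
lower triangular square root of `A` with strictly positive diagonal. -/
structure IsSquareRootFactorization {n : ℕ} (A R : Matrix (Fin n) (Fin n) ℝ) : Prop where
  lower : ∀ i j, i < j → R i j = 0
  diag_pos : ∀ i, 0 < R i i
  mul_self : R * R = A

theorem frobenius_norm_sq {m n : ℕ} (M : Matrix (Fin m) (Fin n) ℝ) :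
    ‖M‖ ^ 2 = ∑ i, ∑ j, M i j ^ 2 := by
  have h : 0 ≤ ∑ i, ∑ j, M i j ^ 2 := by positivity
  rw [Matrix.frobenius_norm_def]
  simp only [Real.rpow_two, Real.norm_eq_abs, sq_abs]
  rw [← Real.sqrt_eq_rpow, Real.sq_sqrt h]

open MeasureTheory ProbabilityTheory in
/-- The closed form in `approxError` comes from the expected squared error of the mechanism
`Θ^MF = B (C X + Z)`, with `Z` a matrix of independent `N(0, s²)` entries: for `s = sens_{k,b}(C)`,
the expected value of `‖Θ - Θ^MF‖²_F / n` is `approxError²` for each of the `d` columns. -/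
theorem integral_norm_error_sq {m n d : ℕ} (s : NNReal) (A : Matrix (Fin n) (Fin n) ℝ)
    (B : Matrix (Fin n) (Fin m) ℝ) (C : Matrix (Fin m) (Fin n) ℝ) (hA : A = B * C)
    (X : Matrix (Fin n) (Fin d) ℝ) :
    ∫ z : Fin m × Fin d → ℝ, ‖A * X - B * (C * X + Matrix.of fun i j => z (i, j))‖ ^ 2
        ∂(Measure.pi fun _ => gaussianReal 0 (s ^ 2))
      = d * ((s : ℝ) ^ 2 * ‖B‖ ^ 2) := by
  set μ : Measure (Fin m × Fin d → ℝ) := Measure.pi fun _ => gaussianReal 0 (s ^ 2) with hμ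
  have hmem : ∀ p : Fin m × Fin d, MemLp (fun z : Fin m × Fin d → ℝ => z p) 2 μ := fun p =>
    (memLp_id_gaussianReal' 2 (by simp)).comp_measurePreserving
      (measurePreserving_eval (fun _ => gaussianReal 0 (s ^ 2)) p)
  have hmean : ∀ p : Fin m × Fin d, ∫ z, z p ∂μ = 0 := fun p => by
    have h := integral_comp_eval (μ := fun _ : Fin m × Fin d => gaussianReal 0 (s ^ 2)) (i := p)
      (f := fun x : ℝ => x) (by fun_prop)
    exact h.trans integral_id_gaussianReal
  -- the second moment of a linear combination of the entries
  have key : ∀ c : Fin m × Fin d → ℝ,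
      ∫ z, (∑ p, c p * z p) ^ 2 ∂μ = (s : ℝ) ^ 2 * ∑ p, c p ^ 2 := by
    intro c
    have h1 : ∫ z, (∑ p, c p * z p) ∂μ = 0 := by
      rw [integral_finsetSum _ fun p _ => ((hmem p).integrable (by norm_num)).const_mul _]
      simp [integral_const_mul, hmean]
    have h2 := variance_sum_pi (μ := fun _ : Fin m × Fin d => gaussianReal 0 (s ^ 2))
      (X := fun p x => c p * x) (fun p => (memLp_id_gaussianReal' 2 (by simp)).const_mul (c p))
    rw [← variance_of_integral_eq_zero
      (memLp_finsetSum _ fun p _ => (hmem p).const_mul (c p)).aestronglyMeasurable.aemeasurable h1]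
    have h3 : (∑ p, fun z : Fin m × Fin d → ℝ => c p * z p) = fun z => ∑ p, c p * z p := by
      ext z; simp
    rw [h3] at h2
    rw [h2, Finset.mul_sum]
    refine Finset.sum_congr rfl fun p _ => ?_
    rw [variance_const_mul, variance_fun_id_gaussianReal]
    push_cast
    ring
  have hint : ∀ c : Fin m × Fin d → ℝ, Integrable (fun z => (∑ p, c p * z p) ^ 2) μ := fun c =>
    (memLp_finsetSum _ fun p _ => (hmem p).const_mul (c p)).integrable_sq
  have hexp : ∀ z : Fin m × Fin d → ℝ,
      ‖A * X - B * (C * X + Matrix.of fun i j => z (i, j))‖ ^ 2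
        = ∑ i, ∑ k, (∑ p : Fin m × Fin d, (if p.2 = k then B i p.1 else 0) * z p) ^ 2 := by
    intro z
    have h : A * X - B * (C * X + Matrix.of fun i j => z (i, j))
        = -(B * Matrix.of fun i j => z (i, j)) := by
      rw [hA, Matrix.mul_add, Matrix.mul_assoc]; abel
    rw [h, norm_neg, frobenius_norm_sq]
    refine Finset.sum_congr rfl fun i _ => Finset.sum_congr rfl fun k _ => ?_
    simp [Matrix.mul_apply, Fintype.sum_prod_type, ite_mul]
  simp_rw [hexp]
  rw [integral_finsetSum _ fun i _ => integrable_finsetSum _ fun k _ => hint _]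
  simp_rw [integral_finsetSum _ fun k _ => hint _, key, frobenius_norm_sq]
  simp [Fintype.sum_prod_type, ite_pow, Finset.mul_sum]

end

/-!
With a single participation, neighbouring inputs differ in one row by a vector of norm at most `1`,
so the sensitivity of `C` is its largest column norm. This is at least `‖C‖ / √n`, hence the error
of a factorization `A = B * C` is at least `‖B‖ * ‖C‖ / n` (`norm_mul_norm_le_approxError`), and
lower bounds follow by pairing `A` with a matrix of bounded operator norm.

* Pairing with the identity gives `n = tr (B * C) ≤ ‖B‖ * ‖C‖`, so the error is always at least `1`
  (`one_le_approxError`).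
* Pairing with the weights `1 / (i - j)`, which by Hilbert's inequality have operator norm at most
  `π`, gives `log n` when `α = 1`: all entries of the lower triangle are then at least `1`, and the
  weights there sum to `∑ H_i ≥ log n! ≥ n log n - n` (`log_le_approxError`). Hilbert's inequality
  holds because the weights are the sine coefficients of the sawtooth `π - θ`, which is bounded by
  `π` on `[0, 2π]` (`sum_sum_mul_div_sub_le`).

For the upper bound, the workload matrix is the Toeplitz matrix of `1 / ((1 - αX) (1 - βX))`, and
lower triangular Toeplitz matrices multiply like power series. Its square root is therefore the
Toeplitz matrix of `(1 - αX) ^ (-1/2) * (1 - βX) ^ (-1/2)`; a lower triangular square root with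
positive diagonal is unique (`IsSquareRootFactorization.unique`). The error of this factorization is
at most the sum of the squares of the first `n` coefficients. Since the coefficients of
`(1 - X) ^ (-1/2)` are at most `1 / √(i + 1)`, this sum is bounded when `α < 1`, and is
`O(1 + log n)` when `α = 1`, in both cases with a constant depending only on `α` and `β`.
-/

/-! ### Hilbert's inequality -/

/-- The sawtooth `π - θ` has sine coefficients `1 / k`; for `k = 0` both sides vanish, the right
one because `2 * π / 0 = 0`. -/
theorem integral_pi_sub_mul_sin_int_mul (k : ℤ) :
    ∫ θ in (0 : ℝ)..2 * Real.pi, (Real.pi - θ) * Real.sin (k * θ) = 2 * Real.pi / k := by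
  rcases eq_or_ne k 0 with rfl | hk
  · simp
  have hk' : (k : ℝ) ≠ 0 := by exact_mod_cast hk
  have hderiv : ∀ θ : ℝ, HasDerivAt
      (fun t : ℝ => -((Real.pi - t) * Real.cos (k * t)) / k - Real.sin (k * t) / k ^ 2)
      ((Real.pi - θ) * Real.sin (k * θ)) θ := by
    intro θ
    have hlin : HasDerivAt (fun t : ℝ => (k : ℝ) * t) k θ := by
      simpa using (hasDerivAt_id θ).const_mul (k : ℝ)
    have hsub : HasDerivAt (fun t : ℝ => Real.pi - t) (-1) θ := by
      simpa using (hasDerivAt_id θ).const_sub Real.pi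
    have h := (((hsub.mul hlin.cos).neg.div_const (k : ℝ)).sub (hlin.sin.div_const ((k : ℝ) ^ 2)))
    refine h.congr_deriv ?_
    field_simp
    ring
  rw [intervalIntegral.integral_eq_sub_of_hasDerivAt (fun θ _ => hderiv θ)
    (Continuous.intervalIntegrable (by fun_prop) _ _)]
  have hc : Real.cos (k * (2 * Real.pi)) = 1 := Real.cos_int_mul_two_pi k
  have hs : Real.sin (k * (2 * Real.pi)) = 0 := by
    have := Real.sin_int_mul_pi (k * 2)
    push_cast at this
    rwa [mul_assoc] at this
  simp only [hc, hs]
  simp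
  ring

theorem integral_cos_int_mul (k : ℤ) :
    ∫ θ in (0 : ℝ)..2 * Real.pi, Real.cos (k * θ) = if k = 0 then 2 * Real.pi else 0 := by
  split_ifs with hk
  · simp [hk]
  have hk' : (k : ℝ) ≠ 0 := by exact_mod_cast hk
  have hs : Real.sin (k * (2 * Real.pi)) = 0 := by
    have := Real.sin_int_mul_pi (k * 2)
    push_cast at this
    rwa [mul_assoc] at this
  rw [intervalIntegral.integral_comp_mul_left (fun t => Real.cos t) hk']
  simp [hs]

theorem integral_sum_sum_mul_cos {n : ℕ} (x : Fin n → ℝ) :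
    ∫ θ in (0 : ℝ)..2 * Real.pi, ∑ i, ∑ j, x i * x j * Real.cos ((((i : ℕ) : ℤ) - (j : ℕ) : ℤ) * θ)
      = 2 * Real.pi * ∑ i, x i ^ 2 := by
  rw [intervalIntegral.integral_finsetSum fun i _ =>
    Continuous.intervalIntegrable (by fun_prop) _ _, Finset.mul_sum]
  refine Finset.sum_congr rfl fun i _ => ?_
  rw [intervalIntegral.integral_finsetSum fun i _ =>
    Continuous.intervalIntegrable (by fun_prop) _ _]
  simp_rw [intervalIntegral.integral_const_mul, integral_cos_int_mul]
  rw [Finset.sum_eq_single i]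
  · simp; ring
  · intro j _ hj
    have : (((i : ℕ) : ℤ) - (j : ℕ) : ℤ) ≠ 0 := fun h => hj (Fin.ext (by omega))
    rw [if_neg this, mul_zero]
  · simp

theorem sum_sum_mul_cos_sub {n : ℕ} (x y : Fin n → ℝ) (θ : ℝ) :
    ∑ i, ∑ j, x i * y j * Real.cos ((((i : ℕ) : ℤ) - (j : ℕ) : ℤ) * θ)
      = (∑ i, x i * Real.cos ((i : ℕ) * θ)) * (∑ j, y j * Real.cos ((j : ℕ) * θ))
        + (∑ i, x i * Real.sin ((i : ℕ) * θ)) * (∑ j, y j * Real.sin ((j : ℕ) * θ)) := by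
  rw [Finset.sum_mul_sum, Finset.sum_mul_sum, ← Finset.sum_add_distrib]
  refine Finset.sum_congr rfl fun i _ => ?_
  rw [← Finset.sum_add_distrib]
  refine Finset.sum_congr rfl fun j _ => ?_
  push_cast
  rw [sub_mul, Real.cos_sub]
  ring

theorem sum_sum_mul_sin_sub {n : ℕ} (x y : Fin n → ℝ) (θ : ℝ) :
    ∑ i, ∑ j, x i * y j * Real.sin ((((i : ℕ) : ℤ) - (j : ℕ) : ℤ) * θ)
      = (∑ i, x i * Real.sin ((i : ℕ) * θ)) * (∑ j, y j * Real.cos ((j : ℕ) * θ))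
        - (∑ i, x i * Real.cos ((i : ℕ) * θ)) * (∑ j, y j * Real.sin ((j : ℕ) * θ)) := by
  rw [Finset.sum_mul_sum, Finset.sum_mul_sum, ← Finset.sum_sub_distrib]
  refine Finset.sum_congr rfl fun i _ => ?_
  rw [← Finset.sum_sub_distrib]
  refine Finset.sum_congr rfl fun j _ => ?_
  push_cast
  rw [sub_mul, Real.sin_sub]
  ring

/-- Hilbert's inequality in additive form. The diagonal terms vanish because they are divided
by `0`. -/
theorem sum_sum_mul_div_sub_le {n : ℕ} (x y : Fin n → ℝ) :
    ∑ i : Fin n, ∑ j : Fin n, x i * y j / ((((i : ℕ) : ℤ) - (j : ℕ) : ℤ) : ℝ)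
      ≤ Real.pi / 2 * (∑ i, x i ^ 2 + ∑ i, y i ^ 2) := by
  have hpi := Real.pi_pos
  have hleft : ∫ θ in (0 : ℝ)..2 * Real.pi, (Real.pi - θ) *
      ∑ i, ∑ j, x i * y j * Real.sin ((((i : ℕ) : ℤ) - (j : ℕ) : ℤ) * θ)
      = 2 * Real.pi * ∑ i : Fin n, ∑ j : Fin n,
        x i * y j / ((((i : ℕ) : ℤ) - (j : ℕ) : ℤ) : ℝ) := by
    simp_rw [Finset.mul_sum]
    rw [intervalIntegral.integral_finsetSum fun i _ =>
      Continuous.intervalIntegrable (by fun_prop) _ _]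
    refine Finset.sum_congr rfl fun i _ => ?_
    rw [intervalIntegral.integral_finsetSum fun i _ =>
      Continuous.intervalIntegrable (by fun_prop) _ _]
    refine Finset.sum_congr rfl fun j _ => ?_
    simp_rw [mul_left_comm (Real.pi - _), intervalIntegral.integral_const_mul,
      integral_pi_sub_mul_sin_int_mul]
    ring
  have hright : ∫ θ in (0 : ℝ)..2 * Real.pi, Real.pi / 2 *
      (∑ i, ∑ j, x i * x j * Real.cos ((((i : ℕ) : ℤ) - (j : ℕ) : ℤ) * θ)
        + ∑ i, ∑ j, y i * y j * Real.cos ((((i : ℕ) : ℤ) - (j : ℕ) : ℤ) * θ))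
      = 2 * Real.pi * (Real.pi / 2 * (∑ i, x i ^ 2 + ∑ i, y i ^ 2)) := by
    rw [intervalIntegral.integral_const_mul, intervalIntegral.integral_add
      (Continuous.intervalIntegrable (by fun_prop) _ _)
      (Continuous.intervalIntegrable (by fun_prop) _ _),
      integral_sum_sum_mul_cos, integral_sum_sum_mul_cos]
    ring
  refine le_of_mul_le_mul_left ?_ (mul_pos two_pos hpi)
  rw [← hleft, ← hright]
  refine intervalIntegral.integral_mono_on (by positivity)
    (Continuous.intervalIntegrable (by fun_prop) _ _)
    (Continuous.intervalIntegrable (by fun_prop) _ _) fun θ hθ => ?_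
  rw [sum_sum_mul_sin_sub, sum_sum_mul_cos_sub, sum_sum_mul_cos_sub]
  set a := ∑ i, x i * Real.cos ((i : ℕ) * θ)
  set b := ∑ i, x i * Real.sin ((i : ℕ) * θ)
  set c := ∑ i, y i * Real.cos ((i : ℕ) * θ)
  set d := ∑ i, y i * Real.sin ((i : ℕ) * θ)
  have habs : |Real.pi - θ| ≤ Real.pi := abs_le.2 ⟨by linarith [hθ.2], by linarith [hθ.1]⟩
  have hdet : |b * c - a * d| ≤ (a * a + b * b + (c * c + d * d)) / 2 :=
    abs_le.2 ⟨by nlinarith [sq_nonneg (b + c), sq_nonneg (a - d)],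
      by nlinarith [sq_nonneg (b - c), sq_nonneg (a + d)]⟩
  calc (Real.pi - θ) * (b * c - a * d) ≤ |Real.pi - θ| * |b * c - a * d| := by
        rw [← abs_mul]; exact le_abs_self _
    _ ≤ Real.pi * ((a * a + b * b + (c * c + d * d)) / 2) := by gcongr
    _ = _ := by ring

/-- Summing Hilbert's inequality over the inner index of a product `B * C`. -/
theorem sum_sum_mul_apply_div_sub_le {m n : ℕ} (B : Matrix (Fin n) (Fin m) ℝ)
    (C : Matrix (Fin m) (Fin n) ℝ) :
    ∑ i : Fin n, ∑ j : Fin n, (B * C) i j / ((((i : ℕ) : ℤ) - (j : ℕ) : ℤ) : ℝ)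
      ≤ Real.pi / 2 * (‖B‖ ^ 2 + ‖C‖ ^ 2) := by
  have h : ∑ i : Fin n, ∑ j : Fin n, (B * C) i j / ((((i : ℕ) : ℤ) - (j : ℕ) : ℤ) : ℝ)
      = ∑ l, ∑ i : Fin n, ∑ j : Fin n,
        B i l * C l j / ((((i : ℕ) : ℤ) - (j : ℕ) : ℤ) : ℝ) := by
    rw [Finset.sum_comm]
    simp_rw [Matrix.mul_apply, Finset.sum_div]
    rw [Finset.sum_comm]
    rw [Finset.sum_comm (s := Finset.univ (α := Fin m))]
    refine Finset.sum_congr rfl fun i _ => ?_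
    rw [Finset.sum_comm]
  rw [h, frobenius_norm_sq, frobenius_norm_sq, Finset.sum_comm (s := Finset.univ (α := Fin n)),
    ← Finset.sum_add_distrib, Finset.mul_sum]
  exact Finset.sum_le_sum fun l _ => sum_sum_mul_div_sub_le (fun i => B i l) (C l)

/-- The weights `1 / (i - j)` are dual to the nuclear norm: balancing the norms of the two factors
turns the additive bound into a bound by `‖B‖ * ‖C‖`. -/
theorem sum_sum_mul_apply_div_sub_le_pi_mul {m n : ℕ} (B : Matrix (Fin n) (Fin m) ℝ)
    (C : Matrix (Fin m) (Fin n) ℝ) :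
    ∑ i : Fin n, ∑ j : Fin n, (B * C) i j / ((((i : ℕ) : ℤ) - (j : ℕ) : ℤ) : ℝ)
      ≤ Real.pi * (‖B‖ * ‖C‖) := by
  rcases eq_or_ne B 0 with rfl | hB
  · simp
  rcases eq_or_ne C 0 with rfl | hC
  · simp
  have hp := norm_pos_iff.2 hB
  have hq := norm_pos_iff.2 hC
  have ht : 0 < √(‖C‖ / ‖B‖) := Real.sqrt_pos.2 (by positivity)
  have hsq : √(‖C‖ / ‖B‖) ^ 2 = ‖C‖ / ‖B‖ := Real.sq_sqrt (by positivity)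
  have h := sum_sum_mul_apply_div_sub_le (√(‖C‖ / ‖B‖) • B) ((√(‖C‖ / ‖B‖))⁻¹ • C)
  rw [Matrix.smul_mul, Matrix.mul_smul, smul_smul, mul_inv_cancel₀ ht.ne', one_smul, norm_smul,
    norm_smul, Real.norm_of_nonneg ht.le, Real.norm_of_nonneg (inv_nonneg.2 ht.le), mul_pow,
    mul_pow, inv_pow, hsq] at h
  refine h.trans_eq ?_
  field_simp
  ring

/-! ### Sensitivity and error for a single participation -/

theorem frobenius_norm_le_of_sq {m n : ℕ} (M : Matrix (Fin m) (Fin n) ℝ) {s : ℝ} (hs : 0 ≤ s)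
    (h : ∑ i, ∑ j, M i j ^ 2 ≤ s ^ 2) : ‖M‖ ≤ s :=
  abs_le_of_sq_le_sq' (by rwa [frobenius_norm_sq]) hs |>.2

/-- Neighbours with a single participation are mapped by `C` to points at distance at most the
largest column norm of `C`. -/
theorem norm_mul_sub_mul_le_of_neighboring {m n d b : ℕ} {C : Matrix (Fin m) (Fin n) ℝ} {s : ℝ}
    (hs : 0 ≤ s) (hC : ∀ j, ∑ l, C l j ^ 2 ≤ s ^ 2) {X X' : Matrix (Fin n) (Fin d) ℝ}
    (h : Neighboring 1 b X X') : ‖C * X - C * X'‖ ≤ s := by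
  obtain ⟨π, ⟨hcard, -⟩, hoff, hon⟩ := h
  rcases π.eq_empty_or_nonempty with rfl | ⟨i, hi⟩
  · have : X = X' := funext fun i => hoff i (by simp)
    simpa [this] using hs
  have hrow : ∀ j, j ≠ i → X j = X' j := fun j hj =>
    hoff j fun hj' => hj (Finset.card_le_one.1 hcard _ hj' _ hi)
  have hentry : ∀ l p, (C * X - C * X') l p = C l i * (X i p - X' i p) := by
    intro l p
    rw [Matrix.sub_apply, Matrix.mul_apply, Matrix.mul_apply, ← Finset.sum_sub_distrib,
      Finset.sum_eq_single i]
    · ring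
    · intro j _ hj
      rw [hrow j hj, sub_self]
    · simp
  have hv : ∑ p, (X i p - X' i p) ^ 2 ≤ 1 := by
    have h1 := pow_le_one₀ (n := 2) (norm_nonneg _) (hon i hi)
    rw [EuclideanSpace.norm_sq_eq] at h1
    simpa using h1
  refine frobenius_norm_le_of_sq _ hs ?_
  simp_rw [hentry, mul_pow, ← Finset.mul_sum, ← Finset.sum_mul]
  exact (mul_le_of_le_one_right (Finset.sum_nonneg fun _ _ => sq_nonneg _) hv).trans (hC i)

theorem sens_one_le {m n d b : ℕ} {C : Matrix (Fin m) (Fin n) ℝ} {s : ℝ} (hs : 0 ≤ s)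
    (hC : ∀ j, ∑ l, C l j ^ 2 ≤ s ^ 2) : sens d 1 b C ≤ s :=
  Real.sSup_le (by rintro _ ⟨X, X', h, rfl⟩; exact norm_mul_sub_mul_le_of_neighboring hs hC h) hs

theorem sens_nonneg {m n d k b : ℕ} (C : Matrix (Fin m) (Fin n) ℝ) : 0 ≤ sens d k b C :=
  Real.sSup_nonneg (by rintro _ ⟨X, X', -, rfl⟩; exact norm_nonneg _)

theorem bddAbove_norm_neighboring_one {m n d b : ℕ} (C : Matrix (Fin m) (Fin n) ℝ) :
    BddAbove {r : ℝ | ∃ X X' : Matrix (Fin n) (Fin d) ℝ,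
      Neighboring 1 b X X' ∧ r = ‖C * X - C * X'‖} := by
  refine ⟨‖C‖, ?_⟩
  rintro _ ⟨X, X', h, rfl⟩
  refine norm_mul_sub_mul_le_of_neighboring (norm_nonneg _) (fun j => ?_) h
  rw [frobenius_norm_sq]
  exact Finset.sum_le_sum fun l _ =>
    Finset.single_le_sum (f := fun j => C l j ^ 2) (fun _ _ => sq_nonneg _) (Finset.mem_univ j)

/-- The sensitivity dominates every column norm: test it on inputs that differ by a unit vector in
a single row. -/
theorem sum_sq_col_le_sens_sq {m n d b : ℕ} (hd : 1 ≤ d) (C : Matrix (Fin m) (Fin n) ℝ)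
    (j : Fin n) : ∑ l, C l j ^ 2 ≤ sens d 1 b C ^ 2 := by
  let p : Fin d := ⟨0, hd⟩
  let X : Matrix (Fin n) (Fin d) ℝ := Matrix.single j p 1
  have hX : Neighboring 1 b X 0 := by
    refine ⟨{j}, ⟨by simp, by simp⟩, fun i hi => ?_, fun i hi => ?_⟩
    · have : j ≠ i := fun h => hi (by simp [h])
      funext q
      simp [X, this]
    · obtain rfl := Finset.mem_singleton.1 hi
      have : X i - (0 : Matrix (Fin n) (Fin d) ℝ) i = Pi.single p 1 := by
        funext q
        simp [X, Matrix.single_apply, Pi.single_apply, eq_comm]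
      rw [this]
      simp
  have hle : ‖C * X - C * (0 : Matrix (Fin n) (Fin d) ℝ)‖
      ≤ sens d 1 b C :=
    le_csSup (bddAbove_norm_neighboring_one C) ⟨X, 0, hX, rfl⟩
  have hsq := pow_le_pow_left₀ (norm_nonneg _) hle 2
  rw [Matrix.mul_zero, sub_zero, frobenius_norm_sq] at hsq
  refine le_trans (Finset.sum_le_sum fun l _ => ?_) hsq
  refine le_trans (le_of_eq ?_) (Finset.single_le_sum (f := fun q => (C * X) l q ^ 2)
    (fun _ _ => sq_nonneg _) (Finset.mem_univ p))
  simp [X]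

/-- The largest column norm of `C` is at least `‖C‖ / √n`. -/
theorem norm_mul_norm_le_approxError {m n d b : ℕ} (hn : 1 ≤ n) (hd : 1 ≤ d)
    (B : Matrix (Fin n) (Fin m) ℝ) (C : Matrix (Fin m) (Fin n) ℝ) :
    ‖B‖ * ‖C‖ ≤ n * approxError d 1 b B C := by
  have hn' : (0 : ℝ) < √n := Real.sqrt_pos.2 (by exact_mod_cast hn)
  have hsq : √(n : ℝ) ^ 2 = n := Real.sq_sqrt (Nat.cast_nonneg n)
  have hC : ‖C‖ ≤ √n * sens d 1 b C := by
    refine frobenius_norm_le_of_sq _ (mul_nonneg hn'.le (sens_nonneg C)) ?_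
    rw [Finset.sum_comm, mul_pow, hsq]
    calc ∑ j, ∑ l, C l j ^ 2 ≤ ∑ _j : Fin n, sens d 1 b C ^ 2 :=
          Finset.sum_le_sum fun j _ => sum_sq_col_le_sens_sq hd C j
      _ = _ := by simp
  calc ‖B‖ * ‖C‖ ≤ ‖B‖ * (√n * sens d 1 b C) := by gcongr
    _ = √n ^ 2 * approxError d 1 b B C := by
        rw [approxError]; field_simp
    _ = _ := by rw [hsq]

theorem approxError_le {m n d b : ℕ} (hn : 1 ≤ n) {S : ℝ} (hS : 0 ≤ S)
    {B : Matrix (Fin n) (Fin m) ℝ} {C : Matrix (Fin m) (Fin n) ℝ}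
    (hB : ∀ i, ∑ l, B i l ^ 2 ≤ S) (hC : ∀ j, ∑ l, C l j ^ 2 ≤ S) :
    approxError d 1 b B C ≤ S := by
  have hn' : (0 : ℝ) < √n := Real.sqrt_pos.2 (by exact_mod_cast hn)
  have hSS : √S ^ 2 = S := Real.sq_sqrt hS
  have h1 : sens d 1 b C ≤ √S := sens_one_le (Real.sqrt_nonneg _) (by simpa [hSS] using hC)
  have h2 : ‖B‖ ≤ √n * √S := by
    refine frobenius_norm_le_of_sq _ (by positivity) ?_
    rw [mul_pow, hSS, Real.sq_sqrt (Nat.cast_nonneg n)]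
    calc ∑ i, ∑ l, B i l ^ 2 ≤ ∑ _i : Fin n, S := Finset.sum_le_sum fun i _ => hB i
      _ = _ := by simp
  calc approxError d 1 b B C ≤ 1 / √n * √S * (√n * √S) := by
        rw [approxError]
        gcongr
    _ = √S ^ 2 := by field_simp
    _ = S := hSS

/-- Cauchy-Schwarz for the trace. -/
theorem trace_mul_le_norm_mul_norm {m n : ℕ} (B : Matrix (Fin n) (Fin m) ℝ)
    (C : Matrix (Fin m) (Fin n) ℝ) : (B * C).trace ≤ ‖B‖ * ‖C‖ := by
  refine abs_le_of_sq_le_sq' ?_ (by positivity) |>.2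
  have h := Finset.sum_mul_sq_le_sq_mul_sq (Finset.univ : Finset (Fin n × Fin m))
    (fun p => B p.1 p.2) (fun p => C p.2 p.1)
  rw [mul_pow, frobenius_norm_sq, frobenius_norm_sq C,
    Finset.sum_comm (s := Finset.univ (α := Fin m))]
  simpa only [Fintype.sum_prod_type, Matrix.trace, Matrix.diag, Matrix.mul_apply] using h

/-! ### Lower bounds -/

theorem trace_workloadMatrix (n : ℕ) (α β : ℝ) : (workloadMatrix n α β).trace = n := by
  simp [workloadMatrix, Matrix.trace]

theorem one_le_approxError {m n d b : ℕ} {α β : ℝ} (hn : 1 ≤ n) (hd : 1 ≤ d)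
    {B : Matrix (Fin n) (Fin m) ℝ} {C : Matrix (Fin m) (Fin n) ℝ}
    (h : workloadMatrix n α β = B * C) : 1 ≤ approxError d 1 b B C := by
  have h1 := (trace_mul_le_norm_mul_norm B C).trans
    (norm_mul_norm_le_approxError (b := b) hn hd B C)
  rw [← h, trace_workloadMatrix] at h1
  have hn' : (0 : ℝ) < n := by exact_mod_cast hn
  exact le_of_mul_le_mul_left (by simpa using h1) hn'

theorem one_le_workloadMatrix_one {n : ℕ} {β : ℝ} (hβ : 0 ≤ β) {i j : Fin n} (hij : j ≤ i) :
    1 ≤ workloadMatrix n 1 β i j := by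
  simp only [workloadMatrix, Matrix.of_apply, if_pos hij, one_pow, one_mul]
  rw [Finset.sum_range_succ]
  simpa using Finset.sum_nonneg fun l _ => pow_nonneg hβ _

/-- A lower bound for `log n!`. -/
theorem mul_log_sub_le_sum_log (n : ℕ) :
    n * Real.log n - n ≤ ∑ i ∈ Finset.range n, Real.log (i + 1) := by
  induction n with
  | zero => simp
  | succ n ih =>
    rw [Finset.sum_range_succ]
    rcases Nat.eq_zero_or_pos n with rfl | hn
    · simp
    have hn' : (0 : ℝ) < n := by exact_mod_cast hn
    have h := Real.log_le_sub_one_of_pos (x := ((n : ℝ) + 1) / n) (by positivity)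
    rw [Real.log_div (by positivity) hn'.ne'] at h
    have h2 : (n : ℝ) * (Real.log (n + 1) - Real.log n) ≤ 1 := by
      calc (n : ℝ) * (Real.log (n + 1) - Real.log n) ≤ n * ((n + 1) / n - 1) := by gcongr
        _ = 1 := by field_simp; ring
    push_cast
    nlinarith

/-- All entries of the lower triangle are at least `1`, so that each row contributes at least a
harmonic number. -/
theorem mul_log_sub_le_sum_workloadMatrix_div (n : ℕ) {β : ℝ} (hβ : 0 ≤ β) :
    n * Real.log n - n ≤ ∑ i : Fin n, ∑ j : Fin n,
      workloadMatrix n 1 β i j / ((((i : ℕ) : ℤ) - (j : ℕ) : ℤ) : ℝ) := by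
  refine (mul_log_sub_le_sum_log n).trans ?_
  rw [← Fin.sum_univ_eq_sum_range (fun i => Real.log ((i : ℝ) + 1)) n]
  refine Finset.sum_le_sum fun i _ => ?_
  have hlog := log_add_one_le_harmonic (i : ℕ)
  push_cast at hlog
  refine hlog.trans ?_
  have hharm : ((harmonic (i : ℕ) : ℚ) : ℝ)
      = ∑ j ∈ Finset.range n,
        if j < (i : ℕ) then (1 : ℝ) / (((i : ℕ) : ℤ) - (j : ℤ) : ℤ) else 0 := by
    rw [← Finset.sum_filter]
    have hfilter : (Finset.range n).filter (· < (i : ℕ)) = Finset.range i := by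
      ext j
      simp only [Finset.mem_filter, Finset.mem_range]
      have := i.2
      omega
    rw [hfilter, ← Finset.sum_range_reflect, harmonic]
    push_cast
    refine Finset.sum_congr rfl fun j hj => ?_
    have hj' : j < (i : ℕ) := Finset.mem_range.1 hj
    have : (((i : ℕ) - 1 - j : ℕ) : ℝ) = (i : ℕ) - 1 - j := by
      rw [Nat.cast_sub (by omega), Nat.cast_sub (by omega)]; simp
    rw [this, one_div]
    congr 1
    ring
  rw [hharm, ← Fin.sum_univ_eq_sum_range
    (fun j => if j < (i : ℕ) then (1 : ℝ) / (((i : ℕ) : ℤ) - (j : ℤ) : ℤ) else 0) n]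
  refine Finset.sum_le_sum fun j _ => ?_
  rcases lt_trichotomy j i with hji | rfl | hij
  · rw [if_pos (show (j : ℕ) < i from hji)]
    have hpos : (0 : ℝ) < ((((i : ℕ) : ℤ) - (j : ℕ) : ℤ) : ℝ) := by
      have : (j : ℕ) < i := hji
      exact_mod_cast (by omega : (0 : ℤ) < ((i : ℕ) : ℤ) - (j : ℕ))
    gcongr
    exact one_le_workloadMatrix_one hβ hji.le
  · simp
  · rw [if_neg (not_lt.2 (show (i : ℕ) ≤ j from hij.le))]
    simp [workloadMatrix, not_le.2 hij]

theorem log_le_approxError {m n d b : ℕ} {β : ℝ} (hβ : 0 ≤ β) (hn : 1 ≤ n) (hd : 1 ≤ d)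
    {B : Matrix (Fin n) (Fin m) ℝ} {C : Matrix (Fin m) (Fin n) ℝ}
    (h : workloadMatrix n 1 β = B * C) :
    1 / (Real.pi + 1) * Real.log n ≤ approxError d 1 b B C := by
  have hn' : (0 : ℝ) < n := by exact_mod_cast hn
  have h1 := mul_log_sub_le_sum_workloadMatrix_div n hβ
  rw [h] at h1
  have h2 := h1.trans (sum_sum_mul_apply_div_sub_le_pi_mul B C)
  have h3 : Real.pi * (‖B‖ * ‖C‖) ≤ Real.pi * (n * approxError d 1 b B C) :=
    mul_le_mul_of_nonneg_left (norm_mul_norm_le_approxError hn hd B C) Real.pi_pos.le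
  have h4 : (1 : ℝ) ≤ approxError d 1 b B C := one_le_approxError hn hd h
  have h5 : Real.log n - 1 ≤ Real.pi * approxError d 1 b B C :=
    le_of_mul_le_mul_left (by linarith) hn'
  rw [one_div_mul_eq_div, div_le_iff₀ (by positivity)]
  linarith

/-! ### The square root of a geometric series -/

/-- The binomial series `(1 - X) ^ (-1/2)`, with coefficients `(2i choose i) / 4 ^ i`. -/
noncomputable def invSqrtOneSub : PowerSeries ℝ :=
  PowerSeries.mk fun i => (Nat.centralBinom i : ℝ) / 4 ^ i

theorem coeff_invSqrtOneSub (i : ℕ) :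
    PowerSeries.coeff i invSqrtOneSub = (Nat.centralBinom i : ℝ) / 4 ^ i := by
  simp [invSqrtOneSub]

theorem coeff_invSqrtOneSub_nonneg (i : ℕ) : 0 ≤ PowerSeries.coeff i invSqrtOneSub := by
  rw [coeff_invSqrtOneSub]; positivity

theorem coeff_succ_invSqrtOneSub (i : ℕ) :
    PowerSeries.coeff (i + 1) invSqrtOneSub * (i + 1)
      = (i + 1 / 2) * PowerSeries.coeff i invSqrtOneSub := by
  have h : ((i : ℝ) + 1) * Nat.centralBinom (i + 1) = 2 * (2 * i + 1) * Nat.centralBinom i := by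
    exact_mod_cast Nat.succ_mul_centralBinom_succ i
  rw [coeff_invSqrtOneSub, coeff_invSqrtOneSub, pow_succ]
  field_simp
  linear_combination 2 * h

open PowerSeries in
theorem one_sub_X_mul_derivative_invSqrtOneSub :
    2 * ((1 - X) * derivative ℝ invSqrtOneSub) = invSqrtOneSub := by
  ext i
  have h2 : (2 : PowerSeries ℝ) = PowerSeries.C 2 := (map_ofNat PowerSeries.C 2).symm
  rw [h2, coeff_C_mul, sub_mul, one_mul, map_sub]
  cases i with
  | zero =>
    rw [coeff_zero_X_mul, coeff_derivative, coeff_succ_invSqrtOneSub]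
    simp
  | succ i =>
    rw [coeff_succ_X_mul, coeff_derivative, coeff_derivative, coeff_succ_invSqrtOneSub]
    push_cast
    ring

open PowerSeries in
/-- Both `invSqrtOneSub ^ 2 * (1 - X)` and `1` have derivative `0` and constant term `1`. -/
theorem invSqrtOneSub_mul_self : invSqrtOneSub * invSqrtOneSub = PowerSeries.mk 1 := by
  have h : invSqrtOneSub * invSqrtOneSub * (1 - X) = 1 := by
    refine derivative.ext (R := ℝ) ?_ ?_
    · have h1 := one_sub_X_mul_derivative_invSqrtOneSub
      simp only [Derivation.leibniz, map_sub, derivative_X, smul_eq_mul, derivative_one]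
      linear_combination invSqrtOneSub * h1
    · have h0 : constantCoeff invSqrtOneSub = 1 := by
        rw [← coeff_zero_eq_constantCoeff_apply, coeff_invSqrtOneSub]; simp
      simp [h0]
  have h1 : (PowerSeries.mk 1 : PowerSeries ℝ) * (1 - X) = 1 := mk_one_mul_one_sub_eq_one ℝ
  calc invSqrtOneSub * invSqrtOneSub
      = invSqrtOneSub * invSqrtOneSub * ((PowerSeries.mk 1 : PowerSeries ℝ) * (1 - X)) := by
        rw [h1, mul_one]
    _ = invSqrtOneSub * invSqrtOneSub * (1 - X) * (PowerSeries.mk 1 : PowerSeries ℝ) := by ring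
    _ = _ := by rw [h, one_mul]

theorem coeff_invSqrtOneSub_sq_mul_le_one (i : ℕ) :
    PowerSeries.coeff i invSqrtOneSub ^ 2 * (i + 1) ≤ 1 := by
  induction i with
  | zero => simp [coeff_invSqrtOneSub]
  | succ i ih =>
    have h := coeff_succ_invSqrtOneSub i
    set x := PowerSeries.coeff i invSqrtOneSub
    set y := PowerSeries.coeff (i + 1) invSqrtOneSub
    have hi : (0 : ℝ) < i + 1 := by positivity
    have hy : y = (i + 1 / 2) * x / (i + 1) := by rw [eq_div_iff hi.ne', h]
    push_cast
    refine le_trans ?_ ih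
    rw [hy, div_pow, mul_pow, div_mul_eq_mul_div, div_le_iff₀ (by positivity)]
    have hpoly : ((i : ℝ) + 1 / 2) ^ 2 * (i + 1 + 1) ≤ (i + 1) * (i + 1) ^ 2 := by
      nlinarith [Nat.cast_nonneg (α := ℝ) i]
    nlinarith [mul_le_mul_of_nonneg_left hpoly (sq_nonneg x)]

theorem coeff_invSqrtOneSub_mul_sqrt_le_one (i : ℕ) :
    PowerSeries.coeff i invSqrtOneSub * √((i : ℝ) + 1) ≤ 1 := by
  refine abs_le_of_sq_le_sq' ?_ zero_le_one |>.2
  rw [mul_pow, Real.sq_sqrt (by positivity), one_pow]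
  exact coeff_invSqrtOneSub_sq_mul_le_one i

theorem coeff_invSqrtOneSub_le_one (i : ℕ) : PowerSeries.coeff i invSqrtOneSub ≤ 1 := by
  refine le_trans (le_mul_of_one_le_right (coeff_invSqrtOneSub_nonneg i) ?_)
    (coeff_invSqrtOneSub_mul_sqrt_le_one i)
  rw [Real.one_le_sqrt]
  linarith [Nat.cast_nonneg (α := ℝ) i]

/-! ### Lower triangular Toeplitz matrices -/

/-- The `n × n` lower triangular Toeplitz matrix whose first column consists of the coefficients
of `f`. -/
noncomputable def lowerToeplitz (n : ℕ) (f : PowerSeries ℝ) : Matrix (Fin n) (Fin n) ℝ :=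
  Matrix.of fun i j => if j ≤ i then PowerSeries.coeff ((i : ℕ) - (j : ℕ)) f else 0

theorem lowerToeplitz_mul (n : ℕ) (f g : PowerSeries ℝ) :
    lowerToeplitz n (f * g) = lowerToeplitz n f * lowerToeplitz n g := by
  ext i j
  simp only [lowerToeplitz, Matrix.of_apply, Matrix.mul_apply]
  split_ifs with hij
  · have hij' : (j : ℕ) ≤ i := hij
    have hi := i.2
    rw [mul_comm f g, PowerSeries.coeff_mul, Finset.Nat.sum_antidiagonal_eq_sum_range_succ_mk]
    have hterm : ∀ k : Fin n,
        ((if k ≤ i then PowerSeries.coeff ((i : ℕ) - (k : ℕ)) f else 0) *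
          (if j ≤ k then PowerSeries.coeff ((k : ℕ) - (j : ℕ)) g else 0))
        = (fun k : ℕ => if (j : ℕ) ≤ k ∧ k ≤ i then
          PowerSeries.coeff (k - (j : ℕ)) g * PowerSeries.coeff ((i : ℕ) - k) f else 0) k := by
      intro k
      simp only [Fin.le_def]
      split_ifs <;> first | (exfalso; omega) | ring
    simp_rw [hterm]
    rw [Fin.sum_univ_eq_sum_range (fun k : ℕ => if (j : ℕ) ≤ k ∧ k ≤ i then
          PowerSeries.coeff (k - (j : ℕ)) g * PowerSeries.coeff ((i : ℕ) - k) f else 0) n,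
      ← Finset.sum_filter]
    have hfilter : (Finset.range n).filter (fun k => (j : ℕ) ≤ k ∧ k ≤ i)
        = Finset.Ico (j : ℕ) (i + 1) := by
      ext k
      simp only [Finset.mem_filter, Finset.mem_range, Finset.mem_Ico]
      omega
    rw [hfilter, Finset.sum_Ico_eq_sum_range, show (i : ℕ) + 1 - j = i - j + 1 by omega]
    refine Finset.sum_congr rfl fun k hk => ?_
    have := Finset.mem_range.1 hk
    rw [Nat.add_sub_cancel_left, Nat.sub_sub]
  · refine (Finset.sum_eq_zero fun k _ => ?_).symm
    rw [not_le] at hij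
    by_cases hki : k ≤ i
    · rw [if_neg (not_le.2 (hki.trans_lt hij)), mul_zero]
    · rw [if_neg hki, zero_mul]

theorem sum_sq_row_lowerToeplitz_le {n : ℕ} (f : PowerSeries ℝ) (i : Fin n) :
    ∑ j, lowerToeplitz n f i j ^ 2 ≤ ∑ l ∈ Finset.range n, PowerSeries.coeff l f ^ 2 := by
  have hterm : ∀ j : Fin n, lowerToeplitz n f i j ^ 2
      = (fun j : ℕ => if j ≤ i then PowerSeries.coeff ((i : ℕ) - j) f ^ 2 else 0) j := by
    intro j
    simp only [lowerToeplitz, Matrix.of_apply, Fin.le_def]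
    split_ifs <;> simp
  simp_rw [hterm]
  rw [Fin.sum_univ_eq_sum_range (fun j : ℕ => if j ≤ i then PowerSeries.coeff ((i : ℕ) - j) f ^ 2
    else 0) n, ← Finset.sum_filter]
  have hfilter : (Finset.range n).filter (fun j => j ≤ (i : ℕ)) = Finset.range (i + 1) := by
    have := i.2
    ext k
    simp only [Finset.mem_filter, Finset.mem_range]
    omega
  rw [hfilter]
  have hreflect := Finset.sum_range_reflect (fun l => PowerSeries.coeff l f ^ 2) ((i : ℕ) + 1)
  simp only [Nat.add_sub_cancel] at hreflect
  rw [hreflect]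
  exact Finset.sum_le_sum_of_subset_of_nonneg (Finset.range_subset_range.2 i.2)
    fun _ _ _ => sq_nonneg _

theorem sum_sq_col_lowerToeplitz_le {n : ℕ} (f : PowerSeries ℝ) (j : Fin n) :
    ∑ i, lowerToeplitz n f i j ^ 2 ≤ ∑ l ∈ Finset.range n, PowerSeries.coeff l f ^ 2 := by
  have hterm : ∀ i : Fin n, lowerToeplitz n f i j ^ 2
      = (fun i : ℕ => if (j : ℕ) ≤ i then PowerSeries.coeff (i - (j : ℕ)) f ^ 2 else 0) i := by
    intro i
    simp only [lowerToeplitz, Matrix.of_apply, Fin.le_def]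
    split_ifs <;> simp
  simp_rw [hterm]
  rw [Fin.sum_univ_eq_sum_range (fun i : ℕ => if (j : ℕ) ≤ i then
    PowerSeries.coeff (i - (j : ℕ)) f ^ 2 else 0) n, ← Finset.sum_filter]
  have hfilter : (Finset.range n).filter (fun i => (j : ℕ) ≤ i) = Finset.Ico (j : ℕ) n := by
    ext k
    simp only [Finset.mem_filter, Finset.mem_range, Finset.mem_Ico]
    omega
  rw [hfilter, Finset.sum_Ico_eq_sum_range]
  simp only [Nat.add_sub_cancel_left]
  exact Finset.sum_le_sum_of_subset_of_nonneg (Finset.range_subset_range.2 (Nat.sub_le _ _))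
    fun _ _ _ => sq_nonneg _

/-! ### The square root of the workload matrix -/

/-- The power series `(1 - αX) ^ (-1/2) * (1 - βX) ^ (-1/2)`. -/
noncomputable def workloadSqrt (α β : ℝ) : PowerSeries ℝ :=
  PowerSeries.rescale α invSqrtOneSub * PowerSeries.rescale β invSqrtOneSub

theorem coeff_workloadSqrt (α β : ℝ) (j : ℕ) :
    PowerSeries.coeff j (workloadSqrt α β) = ∑ l ∈ Finset.range (j + 1),
      (α ^ l * PowerSeries.coeff l invSqrtOneSub) *
        (β ^ (j - l) * PowerSeries.coeff (j - l) invSqrtOneSub) := by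
  rw [workloadSqrt, PowerSeries.coeff_mul, Finset.Nat.sum_antidiagonal_eq_sum_range_succ_mk]
  simp only [PowerSeries.coeff_rescale]

theorem lowerToeplitz_workloadSqrt_mul_self (n : ℕ) (α β : ℝ) :
    lowerToeplitz n (workloadSqrt α β) * lowerToeplitz n (workloadSqrt α β)
      = workloadMatrix n α β := by
  have h : workloadSqrt α β * workloadSqrt α β
      = PowerSeries.rescale α (PowerSeries.mk 1) * PowerSeries.rescale β (PowerSeries.mk 1) := by
    rw [← invSqrtOneSub_mul_self, map_mul, map_mul, workloadSqrt]
    ring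
  rw [← lowerToeplitz_mul, h]
  ext i j
  simp only [lowerToeplitz, workloadMatrix, Matrix.of_apply]
  rw [PowerSeries.coeff_mul, Finset.Nat.sum_antidiagonal_eq_sum_range_succ_mk]
  simp [PowerSeries.coeff_rescale]

theorem isSquareRootFactorization_lowerToeplitz (n : ℕ) (α β : ℝ) :
    IsSquareRootFactorization (workloadMatrix n α β) (lowerToeplitz n (workloadSqrt α β)) where
  lower i j hij := by simp [lowerToeplitz, not_le.2 hij]
  diag_pos i := by simp [lowerToeplitz, coeff_workloadSqrt, coeff_invSqrtOneSub]
  mul_self := lowerToeplitz_workloadSqrt_mul_self n α β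

/-- A lower triangular square root with positive diagonal is unique: for two such roots `R` and `S`
the difference `D = R - S` satisfies `R * D + D * S = 0`, which determines `D` one subdiagonal at a
time. -/
theorem IsSquareRootFactorization.unique {n : ℕ} {A R S : Matrix (Fin n) (Fin n) ℝ}
    (hR : IsSquareRootFactorization A R) (hS : IsSquareRootFactorization A S) : R = S := by
  have hD : R * (R - S) + (R - S) * S = 0 := by
    rw [Matrix.mul_sub, Matrix.sub_mul, hR.mul_self, hS.mul_self]; abel
  have key : ∀ k : ℕ, ∀ i j : Fin n, (i : ℕ) = j + k → (R - S) i j = 0 := by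
    intro k
    induction k using Nat.strong_induction_on with
    | _ k ih =>
      intro i j hij
      have hz : ∀ p q : Fin n, (p : ℕ) < q + k → (R - S) p q = 0 := by
        intro p q hpq
        rcases lt_or_ge (p : ℕ) q with h | h
        · rw [Matrix.sub_apply, hR.lower p q h, hS.lower p q h, sub_zero]
        · exact ih ((p : ℕ) - q) (by omega) p q (by omega)
      have h1 : (R * (R - S)) i j = R i i * (R - S) i j := by
        rw [Matrix.mul_apply, Finset.sum_eq_single i]
        · intro p _ hp
          rcases lt_or_gt_of_ne hp with h | h
          · have : (p : ℕ) < i := h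
            rw [hz p j (by omega), mul_zero]
          · rw [hR.lower i p h, zero_mul]
        · simp
      have h2 : ((R - S) * S) i j = (R - S) i j * S j j := by
        rw [Matrix.mul_apply, Finset.sum_eq_single j]
        · intro p _ hp
          rcases lt_or_gt_of_ne hp with h | h
          · rw [hS.lower p j h, mul_zero]
          · have : (j : ℕ) < p := h
            rw [hz i p (by omega), zero_mul]
        · simp
      have h3 := congrFun (congrFun hD i) j
      rw [Matrix.add_apply, h1, h2, Matrix.zero_apply] at h3
      have h4 : (R i i + S j j) * (R - S) i j = 0 := by linear_combination h3
      exact (mul_eq_zero.1 h4).resolve_left (add_pos (hR.diag_pos i) (hS.diag_pos j)).ne'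
  ext i j
  rcases lt_or_ge (i : ℕ) j with h | h
  · rw [hR.lower i j h, hS.lower i j h]
  · exact sub_eq_zero.1 (key ((i : ℕ) - j) i j (by omega))

theorem approxError_lowerToeplitz_le {n d b : ℕ} (hn : 1 ≤ n) (f : PowerSeries ℝ) :
    approxError d 1 b (lowerToeplitz n f) (lowerToeplitz n f)
      ≤ ∑ l ∈ Finset.range n, PowerSeries.coeff l f ^ 2 :=
  approxError_le hn (Finset.sum_nonneg fun _ _ => sq_nonneg _) (sum_sq_row_lowerToeplitz_le f)
    (sum_sq_col_lowerToeplitz_le f)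

theorem coeff_workloadSqrt_nonneg {α β : ℝ} (hα : 0 ≤ α) (hβ : 0 ≤ β) (j : ℕ) :
    0 ≤ PowerSeries.coeff j (workloadSqrt α β) := by
  rw [coeff_workloadSqrt]
  exact Finset.sum_nonneg fun l _ =>
    mul_nonneg (mul_nonneg (pow_nonneg hα _) (coeff_invSqrtOneSub_nonneg _))
      (mul_nonneg (pow_nonneg hβ _) (coeff_invSqrtOneSub_nonneg _))

theorem coeff_workloadSqrt_le {α β : ℝ} (hβ : 0 ≤ β) (hαβ : β < α) (j : ℕ) :
    PowerSeries.coeff j (workloadSqrt α β) ≤ α ^ j * (1 - β / α)⁻¹ := by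
  have hα : 0 < α := hβ.trans_lt hαβ
  have hq : β / α < 1 := (div_lt_one hα).2 hαβ
  have hq0 : 0 ≤ β / α := by positivity
  rw [coeff_workloadSqrt, ← Finset.sum_range_reflect]
  calc _ ≤ ∑ l ∈ Finset.range (j + 1), α ^ j * (β / α) ^ l := by
        refine Finset.sum_le_sum fun l hl => ?_
        have hl' : l ≤ j := Nat.lt_succ_iff.1 (Finset.mem_range.1 hl)
        rw [show j + 1 - 1 - l = j - l by omega, show j - (j - l) = l by omega]
        calc _ ≤ α ^ (j - l) * 1 * (β ^ l * 1) := by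
              have h1 := coeff_invSqrtOneSub_le_one l
              have h2 := coeff_invSqrtOneSub_le_one (j - l)
              have h3 := coeff_invSqrtOneSub_nonneg l
              gcongr
          _ = α ^ j * (β / α) ^ l := by
              rw [div_pow, ← Nat.sub_add_cancel hl', pow_add, Nat.add_sub_cancel]
              field_simp
    _ = α ^ j * ∑ l ∈ Finset.range (j + 1), (β / α) ^ l := by rw [Finset.mul_sum]
    _ ≤ α ^ j * (1 - β / α)⁻¹ := by
        gcongr
        rw [← tsum_geometric_of_lt_one hq0 hq]
        exact (summable_geometric_of_lt_one hq0 hq).sum_le_tsum _ fun _ _ => pow_nonneg hq0 _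

theorem sum_sq_coeff_workloadSqrt_le {α β : ℝ} (hβ : 0 ≤ β) (hαβ : β < α) (hα1 : α < 1) (n : ℕ) :
    ∑ j ∈ Finset.range n, PowerSeries.coeff j (workloadSqrt α β) ^ 2
      ≤ (1 - β / α)⁻¹ ^ 2 * (1 - α ^ 2)⁻¹ := by
  have hα : 0 < α := hβ.trans_lt hαβ
  have hq : α ^ 2 < 1 := pow_lt_one₀ hα.le hα1 two_ne_zero
  calc _ ≤ ∑ j ∈ Finset.range n, (1 - β / α)⁻¹ ^ 2 * (α ^ 2) ^ j := by
        refine Finset.sum_le_sum fun j _ => ?_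
        calc _ ≤ (α ^ j * (1 - β / α)⁻¹) ^ 2 :=
              pow_le_pow_left₀ (coeff_workloadSqrt_nonneg hα.le hβ j)
                (coeff_workloadSqrt_le hβ hαβ j) 2
          _ = _ := by ring
    _ = (1 - β / α)⁻¹ ^ 2 * ∑ j ∈ Finset.range n, (α ^ 2) ^ j := by rw [Finset.mul_sum]
    _ ≤ _ := by
        gcongr
        rw [← tsum_geometric_of_lt_one (by positivity) hq]
        exact (summable_geometric_of_lt_one (by positivity) hq).sum_le_tsum _
          fun _ _ => by positivity

/-- Without weight decay the coefficients decay like `1 / √(j + 1)`. This uses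
`√(j + 1) ≤ √(j - l + 1) * √(l + 1)`, the factor `√(l + 1)` being absorbed by `β ^ l`. -/
theorem coeff_workloadSqrt_one_mul_sqrt_le {β : ℝ} (hβ : 0 ≤ β) (hβ1 : β < 1) (j : ℕ) :
    PowerSeries.coeff j (workloadSqrt 1 β) * √((j : ℝ) + 1) ≤ (1 - β)⁻¹ := by
  rw [coeff_workloadSqrt, ← Finset.sum_range_reflect, Finset.sum_mul]
  calc _ ≤ ∑ l ∈ Finset.range (j + 1), β ^ l := by
        refine Finset.sum_le_sum fun l hl => ?_
        have hl' : l ≤ j := Nat.lt_succ_iff.1 (Finset.mem_range.1 hl)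
        rw [show j + 1 - 1 - l = j - l by omega, show j - (j - l) = l by omega, one_pow, one_mul]
        have hsqrt : √((j : ℝ) + 1) ≤ √(((j - l : ℕ) : ℝ) + 1) * √((l : ℝ) + 1) := by
          rw [← Real.sqrt_mul (by positivity)]
          refine Real.sqrt_le_sqrt ?_
          have hj : (j : ℝ) = ((j - l : ℕ) : ℝ) + l := by
            rw [Nat.cast_sub hl']; ring
          nlinarith [Nat.cast_nonneg (α := ℝ) (j - l), Nat.cast_nonneg (α := ℝ) l,
            mul_nonneg (Nat.cast_nonneg (α := ℝ) (j - l)) (Nat.cast_nonneg (α := ℝ) l)]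
        have h1 := coeff_invSqrtOneSub_mul_sqrt_le_one l
        have h2 := coeff_invSqrtOneSub_mul_sqrt_le_one (j - l)
        have h3 := coeff_invSqrtOneSub_nonneg l
        have h4 := coeff_invSqrtOneSub_nonneg (j - l)
        set x := PowerSeries.coeff l invSqrtOneSub
        set y := PowerSeries.coeff (j - l) invSqrtOneSub
        calc y * (β ^ l * x) * √((j : ℝ) + 1)
            ≤ y * (β ^ l * x) * (√(((j - l : ℕ) : ℝ) + 1) * √((l : ℝ) + 1)) := by gcongr
          _ = β ^ l * ((y * √(((j - l : ℕ) : ℝ) + 1)) * (x * √((l : ℝ) + 1))) := by ring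
          _ ≤ β ^ l * (1 * 1) := by gcongr
          _ = β ^ l := by ring
    _ ≤ (1 - β)⁻¹ := by
        rw [← tsum_geometric_of_lt_one hβ hβ1]
        exact (summable_geometric_of_lt_one hβ hβ1).sum_le_tsum _ fun _ _ => pow_nonneg hβ _

theorem sum_sq_coeff_workloadSqrt_one_le {β : ℝ} (hβ : 0 ≤ β) (hβ1 : β < 1) (n : ℕ) :
    ∑ j ∈ Finset.range n, PowerSeries.coeff j (workloadSqrt 1 β) ^ 2
      ≤ (1 - β)⁻¹ ^ 2 * (1 + Real.log n) := by
  calc _ ≤ ∑ j ∈ Finset.range n, (1 - β)⁻¹ ^ 2 * ((j : ℝ) + 1)⁻¹ := by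
        refine Finset.sum_le_sum fun j _ => ?_
        rw [← div_eq_mul_inv, le_div_iff₀ (by positivity)]
        have h := pow_le_pow_left₀ (mul_nonneg (coeff_workloadSqrt_nonneg zero_le_one hβ j)
          (Real.sqrt_nonneg _)) (coeff_workloadSqrt_one_mul_sqrt_le hβ hβ1 j) 2
        rwa [mul_pow, Real.sq_sqrt (by positivity)] at h
    _ = (1 - β)⁻¹ ^ 2 * ((harmonic n : ℚ) : ℝ) := by
        rw [← Finset.mul_sum, harmonic]; push_cast; rfl
    _ ≤ _ := by
        gcongr
        exact harmonic_le_one_add_log n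

/-! ### Optimality -/

theorem mainTheorem6 :
    -- lower bound for `α < 1`
    (∃ c : ℝ, 0 < c ∧ ∀ α β : ℝ, 0 ≤ β → β < α → α < 1 →
      ∀ n : ℕ, 1 ≤ n → ∀ b : ℕ, 1 ≤ b → b ≤ n → ∀ d : ℕ, 1 ≤ d →
      ∀ (m : ℕ) (B : Matrix (Fin n) (Fin m) ℝ) (C : Matrix (Fin m) (Fin n) ℝ),
        workloadMatrix n α β = B * C → c ≤ approxError d 1 b B C) ∧
    -- lower bound for `α = 1`
    (∃ c : ℝ, 0 < c ∧ ∀ β : ℝ, 0 ≤ β → β < 1 →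
      ∀ n : ℕ, 1 ≤ n → ∀ b : ℕ, 1 ≤ b → b ≤ n → ∀ d : ℕ, 1 ≤ d →
      ∀ (m : ℕ) (B : Matrix (Fin n) (Fin m) ℝ) (C : Matrix (Fin m) (Fin n) ℝ),
        workloadMatrix n 1 β = B * C → c * Real.log n ≤ approxError d 1 b B C) ∧
    -- the square root factorization is optimal up to a factor that does not depend on `n`
    (∀ α β : ℝ, 0 ≤ β → β < α → α ≤ 1 → ∃ K : ℝ, 0 < K ∧
      ∀ n : ℕ, 1 ≤ n →
        (∃ R, IsSquareRootFactorization (workloadMatrix n α β) R) ∧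
        ∀ R, IsSquareRootFactorization (workloadMatrix n α β) R →
          ∀ b : ℕ, 1 ≤ b → b ≤ n → ∀ d : ℕ, 1 ≤ d →
          ∀ (m : ℕ) (B : Matrix (Fin n) (Fin m) ℝ) (C : Matrix (Fin m) (Fin n) ℝ),
            workloadMatrix n α β = B * C →
              approxError d 1 b R R ≤ K * approxError d 1 b B C) := by
  refine ⟨⟨1, one_pos, ?_⟩, ⟨1 / (Real.pi + 1), by positivity, ?_⟩, ?_⟩
  · intro α β _ _ _ n hn b _ _ d hd m B C h
    exact one_le_approxError hn hd h
  · intro β hβ _ n hn b _ _ d hd m B C h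
    exact log_le_approxError hβ hn hd h
  · intro α β hβ hαβ hα
    have hαpos : 0 < α := hβ.trans_lt hαβ
    rcases hα.lt_or_eq with hα1 | rfl
    · have hq : 0 < 1 - β / α := sub_pos.2 ((div_lt_one hαpos).2 hαβ)
      have hα2 : 0 < 1 - α ^ 2 := sub_pos.2 (pow_lt_one₀ hαpos.le hα1 two_ne_zero)
      refine ⟨(1 - β / α)⁻¹ ^ 2 * (1 - α ^ 2)⁻¹, by positivity, fun n hn =>
        ⟨⟨_, isSquareRootFactorization_lowerToeplitz n α β⟩, fun R hR b _ _ d hd m B C h => ?_⟩⟩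
      rw [hR.unique (isSquareRootFactorization_lowerToeplitz n α β)]
      exact (approxError_lowerToeplitz_le hn _).trans
        ((sum_sq_coeff_workloadSqrt_le hβ hαβ hα1 n).trans
          (le_mul_of_one_le_right (by positivity) (one_le_approxError hn hd h)))
    · have hq : 0 < 1 - β := sub_pos.2 hαβ
      refine ⟨(1 - β)⁻¹ ^ 2 * (Real.pi + 2), by positivity, fun n hn =>
        ⟨⟨_, isSquareRootFactorization_lowerToeplitz n 1 β⟩, fun R hR b _ _ d hd m B C h => ?_⟩⟩
      rw [hR.unique (isSquareRootFactorization_lowerToeplitz n 1 β), mul_assoc]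
      refine (approxError_lowerToeplitz_le hn _).trans
        ((sum_sq_coeff_workloadSqrt_one_le hβ hαβ n).trans ?_)
      -- the two lower bounds for the error add up to one for `1 + log n`, also at `n = 1`
      have h1 : (1 : ℝ) ≤ approxError d 1 b B C := one_le_approxError hn hd h
      have h2 : 1 / (Real.pi + 1) * Real.log n ≤ approxError d 1 b B C :=
        log_le_approxError hβ hn hd h
      rw [one_div_mul_eq_div, div_le_iff₀ (by positivity)] at h2
      gcongr
      linarith
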